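/- Let $d>1$ and let $\mathbb N=\{1,2,3,\dots\}$. A $d$-decaying system is a sequence of $C^1$ maps $f_i:[0,1]\to[0,1]$, $i\in\mathbb N$, such that: (1) there are $m\in\mathbb N$ and $0<A<1$ with $0<|(f_{a_1}\circ\cdots\circ f_{a_m})'(x)|\le A$ for all $(a_1,\dots,a_m)\in\mathbb N^m$ and all $x\in[0,1]$; (2) $f_i((0,1))\cap f_j((0,1))=\emptyset$ for all $i\ne j$; (3) for every $\varepsilon>0$ there are $C_1,C_2>0$ such that for every $i\in\mathbb N$ there are constants $\xi_i,\lambda_i$ with $\xi_i\le|f_i'(x)|\le\lambda_i$ for all $x\in[0,1]$ and $$\frac{C_1}{i^{d+\varepsilon}}\le\xi_i\le\lambda_i\le\frac{C_2}{i^{d-\varepsilon}}.$$ For $\underline a=(a_1,a_2,\dots)\in\mathbb N^{\mathbb N}$ put $\Pi(\underline a)=\lim_{n\to\infty}f_{a_1}\circ\cdots\circ f_{a_n}(1)$, and for $\Phi:\mathbb N\to\mathbb R$ put $$X_\Phi=\Pi\{\underline a\in\mathbb N^{\mathbb N}: a_{n+1}>\Phi(a_n)\text{ for all }n\in\mathbb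 N\}.$$ **Theorem.** Let $\{f_i\}_{i\in\mathbb N}$ be a $d$-decaying system and let $\Phi:\mathbb N\to\mathbb R$ satisfy $\Phi(n)\ge n$ for all $n\in\mathbb N$. Let $s_0=\overline{\dim}_B\{f_i(0):i\in\mathbb N\}$ be the upper box-counting dimension of the set of the points $f_i(0)$. Then the packing dimension of $X_\Phi$ is $$\dim_P X_\Phi=\max\left\{s_0,\frac1d\right\}.$$ -/

import Mathlib

open Set Filter Topology
open scoped NNReal ENNReal

noncomputable section

namespace DecayingIFS

/-- `comp f a n` is the composition `f (a 0) ∘ f (a 1) ∘ ⋯ ∘ f (a (n - 1))` of `n` maps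
(the positions of the digit sequence `a` are counted from `0`). -/
def comp (f : ℕ+ → ℝ → ℝ) (a : ℕ → ℕ+) : ℕ → ℝ → ℝ
  | 0 => id
  | n + 1 => comp f a n ∘ f (a n)

/-- A `d`-decaying system: a sequence `f 1, f 2, …` of `C¹` maps from `[0, 1]` to `[0, 1]`.
Each `f i` is a function on `ℝ` of which only the restriction to `[0, 1]` matters, and
derivatives are taken within `[0, 1]`, so they are one-sided at the end points. -/
structure IsDecaying (d : ℝ) (f : ℕ+ → ℝ → ℝ) : Prop where
  one_lt : 1 < d
  mapsTo : ∀ i, MapsTo (f i) (Icc 0 1) (Icc 0 1)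
  contDiffOn : ∀ i, ContDiffOn ℝ 1 (f i) (Icc 0 1)
  /-- Some fixed number `m` of iterates contracts uniformly. -/
  contracting : ∃ m : ℕ, 1 ≤ m ∧ ∃ A : ℝ, 0 < A ∧ A < 1 ∧
    ∀ a : ℕ → ℕ+, ∀ x ∈ Icc (0 : ℝ) 1,
      0 < |derivWithin (comp f a m) (Icc 0 1) x| ∧ |derivWithin (comp f a m) (Icc 0 1) x| ≤ A
  disjoint : ∀ i j, i ≠ j → f i '' Ioo 0 1 ∩ f j '' Ioo 0 1 = ∅
  /-- The derivatives decay polynomially with exponent `d`. -/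
  decay : ∀ ε : ℝ, 0 < ε → ∃ C₁ C₂ : ℝ, 0 < C₁ ∧ 0 < C₂ ∧ ∀ i : ℕ+, ∃ ξ l : ℝ,
    (∀ x ∈ Icc (0 : ℝ) 1,
      ξ ≤ |derivWithin (f i) (Icc 0 1) x| ∧ |derivWithin (f i) (Icc 0 1) x| ≤ l) ∧
    C₁ / (i : ℝ) ^ (d + ε) ≤ ξ ∧ ξ ≤ l ∧ l ≤ C₂ / (i : ℝ) ^ (d - ε)

/-- `a` is a digit sequence of `x`, that is, `x = Π(a) = lim f_{a_1} ∘ ⋯ ∘ f_{a_n} (1)`. -/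
def IsCoding (f : ℕ+ → ℝ → ℝ) (a : ℕ → ℕ+) (x : ℝ) : Prop :=
  Tendsto (fun n => comp f a n 1) atTop (𝓝 x)

/-- The set `X_Φ` of the points with a digit sequence such that `a_{n+1} > Φ(a_n)` for all `n`. -/
def growthSet (f : ℕ+ → ℝ → ℝ) (Φ : ℕ+ → ℝ) : Set ℝ :=
  {x | ∃ a : ℕ → ℕ+, (∀ n, Φ (a n) < (a (n + 1) : ℝ)) ∧ IsCoding f a x}

/-- The upper box-counting dimension `limsup_{r → 0} log N_r(E) / (- log r)`, where `N_r(E)` is the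
least number of closed balls of radius `r` that cover `E` (the empty set gets dimension `0`). -/
def upperBoxDim (E : Set ℝ) : ℝ≥0∞ :=
  limsup (fun r : ℝ≥0 =>
    (ENNReal.log ((Metric.externalCoveringNumber r E : ℕ∞) : ℝ≥0∞) /
      ((-Real.log (r : ℝ) : ℝ) : EReal)).toENNReal) (𝓝[>] 0)

/-- `P` is a `δ`-packing of `E`: a family of pairs (centre, radius) of disjoint closed balls
with centres in `E` and positive radii at most `δ`. -/
structure IsPacking (δ : ℝ) (E : Set ℝ) (P : Set (ℝ × ℝ)) : Prop where
  center_mem : ∀ p ∈ P, p.1 ∈ E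
  radius_pos : ∀ p ∈ P, 0 < p.2
  radius_le : ∀ p ∈ P, p.2 ≤ δ
  disjoint : P.PairwiseDisjoint fun p => Metric.closedBall p.1 p.2

/-- The supremum of `∑ |B|^s` over all `δ`-packings of `E`, where `|B|` is the diameter. -/
def packingSup (s : ℝ≥0) (δ : ℝ) (E : Set ℝ) : ℝ≥0∞ :=
  ⨆ (P : Set (ℝ × ℝ)) (_ : IsPacking δ E P), ∑' p : P, ENNReal.ofReal (2 * p.1.2) ^ (s : ℝ)

/-- The `s`-dimensional packing premeasure: the limit of `packingSup s δ E` as `δ` decreases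
to `0`. -/
def packingPre (s : ℝ≥0) (E : Set ℝ) : ℝ≥0∞ :=
  ⨅ (δ : ℝ) (_ : 0 < δ), packingSup s δ E

/-- The `s`-dimensional packing measure. -/
def packingMeasure (s : ℝ≥0) (E : Set ℝ) : ℝ≥0∞ :=
  ⨅ (F : ℕ → Set ℝ) (_ : E ⊆ ⋃ i, F i), ∑' i, packingPre s (F i)

/-- The packing dimension `sup {s ≥ 0 : P^s(E) = ∞}`. -/
def packingDim (E : Set ℝ) : ℝ≥0∞ :=
  ⨆ (s : ℝ≥0) (_ : packingMeasure s E = ∞), (s : ℝ≥0∞)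

end DecayingIFS

end

/-!
Everything is reduced to the elementary notion `BoxCovered s E`: the set `E` is covered by
`O(r ^ (-s))` intervals of radius `r`, for all `r ≤ 1`. Upper box dimension less than `s` implies it
and it implies upper box dimension at most `s`. It also controls packings: a box covered set has
packing premeasure `0` in all dimensions greater than `s`
(`packingPre_eq_zero_of_boxCovered`), and a set of finite `s`-dimensional packing premeasure is
`s`-box covered (`boxCovered_of_packingPre_ne_top`).

*Upper bound.* Let `t > max s₀ (1 / d)`. As the digits of a point of `X_Φ` increase strictly, `X_Φ` is
contained in a countable union of sets `f_w(Y)`, where `Y` consists of the points with all digits at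
least `k`, for any fixed `k`. This `Y` is covered by the sets `f_b(Y)` with `b ≥ k`. At scale `r`,
those with `|f_b'| ≲ r` lie near the points `f_b(0)` and need `O(r ^ (-t))` intervals, as `t > s₀`.
Each of the others is a copy of `Y` seen at a larger scale. Since `t > 1 / d`, the sum of
`sup |f_b'| ^ t` over `b ≥ k` is less than `1 / 2` for large `k`, so the bound `O(r ^ (-t))` for `Y`
follows by induction on the scale (`boxCovered_of_subset_iUnion_image`).

*Lower bound.* Suppose that `X_Φ` has finite `s`-dimensional packing measure. Then it is covered by
countably many `s`-box covered sets, and by the Baire category theorem in the space of admissible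
digit sequences the closure of one of them contains the image of a cylinder, hence a bi-Lipschitz
copy of `{f_b(x_b) : b > M}` for some `M` and some points `x_b ∈ [0, 1]`. So this set is `s`-box
covered. Its points lie in intervals of disjoint interiors and lengths at least about `b ^ (-d)`,
which forces `s ≥ 1 / d` (`one_div_le_of_boxCovered`); and all but about `r ^ (-1 / d)` of them are
within `r` of `f_b(0)`, so that `s₀ ≤ s` (`boxCovered_range_zero`).
-/

noncomputable section

namespace DecayingIFS

/-! ### Box covered sets, upper box dimension and packing measures -/

/-- `BoxCovered s E` says that, for all `r ∈ (0, 1]`, the set `E` is covered by `O(r ^ (-s))` closed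
intervals of radius `r` (with arbitrary real centres). -/
def BoxCovered (s : ℝ) (E : Set ℝ) : Prop :=
  ∃ K : ℝ, ∀ r : ℝ, 0 < r → r ≤ 1 →
    ∃ T : Finset ℝ, (T.card : ℝ) ≤ K * r ^ (-s) ∧ ∀ x ∈ E, ∃ y ∈ T, |x - y| ≤ r

lemma BoxCovered.mono {s : ℝ} {E F : Set ℝ} (h : BoxCovered s F) (hEF : E ⊆ F) :
    BoxCovered s E := by
  obtain ⟨K, hK⟩ := h
  refine ⟨K, fun r hr hr1 => ?_⟩
  obtain ⟨T, hT, hc⟩ := hK r hr hr1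
  exact ⟨T, hT, fun x hx => hc x (hEF hx)⟩

/-- Only small radii matter. -/
lemma boxCovered_of_small {s : ℝ} (hs : 0 ≤ s) {E : Set ℝ} {K δ : ℝ} (hδ : 0 < δ)
    (h : ∀ r : ℝ, 0 < r → r ≤ δ →
      ∃ T : Finset ℝ, (T.card : ℝ) ≤ K * r ^ (-s) ∧ ∀ x ∈ E, ∃ y ∈ T, |x - y| ≤ r) :
    BoxCovered s E := by
  obtain ⟨T₀, hT₀, hc₀⟩ := h δ hδ le_rfl
  refine ⟨max K (K * δ ^ (-s)), fun r hr hr1 => ?_⟩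
  have hr0 : (0 : ℝ) < r ^ (-s) := Real.rpow_pos_of_pos hr _
  rcases le_total r δ with hrδ | hrδ
  · obtain ⟨T, hT, hc⟩ := h r hr hrδ
    exact ⟨T, hT.trans (mul_le_mul_of_nonneg_right (le_max_left _ _) hr0.le), hc⟩
  · refine ⟨T₀, ?_, fun x hx => ?_⟩
    · have h1 : 1 ≤ r ^ (-s) := Real.one_le_rpow_of_pos_of_le_one_of_nonpos hr hr1 (by linarith)
      have h0 : (0 : ℝ) ≤ max K (K * δ ^ (-s)) :=
        ((Nat.cast_nonneg _).trans hT₀).trans (le_max_right _ _)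
      calc (T₀.card : ℝ) ≤ max K (K * δ ^ (-s)) := hT₀.trans (le_max_right _ _)
        _ ≤ _ := le_mul_of_one_le_right h0 h1
    · obtain ⟨y, hy, hxy⟩ := hc₀ x hx
      exact ⟨y, hy, hxy.trans hrδ⟩

lemma BoxCovered.closure {s : ℝ} {E : Set ℝ} (h : BoxCovered s E) :
    BoxCovered s (closure E) := by
  obtain ⟨K, hK⟩ := h
  refine ⟨K, fun r hr hr1 => ?_⟩
  obtain ⟨T, hT, hc⟩ := hK r hr hr1
  refine ⟨T, hT, fun x hx => ?_⟩
  have hcl : IsClosed (⋃ y ∈ T, Metric.closedBall y r) :=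
    T.finite_toSet.isClosed_biUnion fun y _ => Metric.isClosed_closedBall
  have hsub : E ⊆ ⋃ y ∈ T, Metric.closedBall y r := fun x hx => by
    obtain ⟨y, hy, hxy⟩ := hc x hx
    exact mem_biUnion hy (by simpa [Real.dist_eq] using hxy)
  have := closure_minimal hsub hcl hx
  simpa [Real.dist_eq] using this

/-- A set parametrised in a Lipschitz way by a box covered set is box covered. Both sets are
parametrised by `ι`, so that no map of the line is needed. -/
lemma BoxCovered.of_lipschitz {ι : Type*} {s : ℝ} {u v : ι → ℝ} {L : ℝ} (hL : 1 ≤ L)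
    (huv : ∀ i j, |u i - u j| ≤ L * |v i - v j|) (h : BoxCovered s (range v)) :
    BoxCovered s (range u) := by
  classical
  obtain ⟨K, hK⟩ := h
  refine ⟨K * (2 * L) ^ s, fun r hr hr1 => ?_⟩
  have hL0 : 0 < 2 * L := by linarith
  obtain ⟨T, hT, hc⟩ := hK (r / (2 * L)) (by positivity)
    ((div_le_one hL0).2 (by linarith))
  have key : ∀ y : ℝ, ∃ z : ℝ, ∀ i, |v i - y| ≤ r / (2 * L) → |u i - z| ≤ r := by
    intro y
    by_cases hy : ∃ i, |v i - y| ≤ r / (2 * L)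
    · obtain ⟨j, hj⟩ := hy
      refine ⟨u j, fun i hi => (huv i j).trans ?_⟩
      have : |v i - v j| ≤ r / (2 * L) + r / (2 * L) := by
        have := abs_sub_le (v i) y (v j)
        rw [abs_sub_comm y] at this
        linarith
      calc L * |v i - v j| ≤ L * (r / (2 * L) + r / (2 * L)) := by gcongr
        _ = r := by field_simp; ring
    · exact ⟨0, fun i hi => (hy ⟨i, hi⟩).elim⟩
  choose z hz using key
  refine ⟨T.image z, ?_, ?_⟩
  · calc ((T.image z).card : ℝ) ≤ T.card := by exact_mod_cast Finset.card_image_le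
      _ ≤ K * (r / (2 * L)) ^ (-s) := hT
      _ = K * (2 * L) ^ s * r ^ (-s) := by
        rw [Real.div_rpow hr.le hL0.le, Real.rpow_neg hL0.le]; field_simp
  · rintro _ ⟨i, rfl⟩
    obtain ⟨y, hy, hxy⟩ := hc _ ⟨i, rfl⟩
    exact ⟨z y, Finset.mem_image_of_mem z hy, hz y i hxy⟩

/-- For `r < 1`, the quotient in `upperBoxDim` is at most `t` exactly when the covering number is at
most `r ^ (-t)`; this includes `N = 0` and `N = ∞`. -/
lemma log_div_neg_log_le_iff {N : ℝ≥0∞} {r : ℝ≥0} (hr : 0 < r) (hr1 : r < 1) (t : ℝ≥0) :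
    (ENNReal.log N / ((-Real.log (r : ℝ) : ℝ) : EReal)).toENNReal ≤ (t : ℝ≥0∞) ↔
      N ≤ ENNReal.ofReal ((r : ℝ) ^ (-(t : ℝ))) := by
  have hr' : (0 : ℝ) < r := hr
  have hL : 0 < -Real.log (r : ℝ) := by
    have := Real.log_neg hr' (by exact_mod_cast hr1)
    linarith
  have hX : ∀ X : EReal, X.toENNReal ≤ (t : ℝ≥0∞) ↔ X ≤ ((t : ℝ) : EReal) := by
    intro X
    have ht : ((t : ℝ) : EReal).toENNReal = (t : ℝ≥0∞) := by simp
    constructor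
    · intro h
      by_contra hlt
      push Not at hlt
      have h1 := EReal.toENNReal_lt_toENNReal (by exact_mod_cast t.2) hlt
      rw [ht] at h1
      exact absurd h (not_le.2 h1)
    · intro h
      rw [← ht]
      exact EReal.toENNReal_le_toENNReal h
  rw [hX, EReal.div_le_iff_le_mul (by exact_mod_cast hL) (EReal.coe_ne_top _)]
  rw [← ENNReal.log_le_log_iff, ENNReal.log_ofReal_of_pos (Real.rpow_pos_of_pos hr' _),
    Real.log_rpow hr']
  have : ((-(t : ℝ) * Real.log r : ℝ) : EReal) = ((-Real.log (r : ℝ) : ℝ) : EReal) * ((t : ℝ) : EReal) := by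
    rw [← EReal.coe_mul]; congr 1; ring
  rw [this]

lemma exists_finset_of_externalCoveringNumber_le {r : ℝ≥0} {E : Set ℝ} {y : ℝ} (hy : 0 ≤ y)
    (h : ((Metric.externalCoveringNumber r E : ℕ∞) : ℝ≥0∞) ≤ ENNReal.ofReal y) :
    ∃ T : Finset ℝ, (T.card : ℝ) ≤ y ∧ ∀ x ∈ E, ∃ z ∈ T, |x - z| ≤ r := by
  have hN : Metric.externalCoveringNumber r E ≠ ⊤ := by
    intro hN
    rw [hN] at h
    simp at h
  obtain ⟨n, hn⟩ := ENat.ne_top_iff_exists.1 hN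
  rw [← hn] at h
  have hny : (n : ℝ) ≤ y := by
    have : ((n : ℕ) : ℝ≥0∞) ≤ ENNReal.ofReal y := by simpa using h
    rw [← ENNReal.ofReal_natCast] at this
    exact (ENNReal.ofReal_le_ofReal_iff hy).1 this
  have hlt : Metric.externalCoveringNumber r E < ((n + 1 : ℕ) : ℕ∞) := by
    rw [← hn]; exact_mod_cast Nat.lt_succ_self n
  unfold Metric.externalCoveringNumber at hlt
  simp only [iInf_lt_iff] at hlt
  obtain ⟨C, hC, hCn⟩ := hlt
  have hfin : C.Finite := by
    rw [← Set.encard_lt_top_iff]; exact hCn.trans_le le_top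
  refine ⟨hfin.toFinset, ?_, fun x hx => ?_⟩
  · rw [hfin.encard_eq_coe_toFinset_card] at hCn
    have : hfin.toFinset.card < n + 1 := by exact_mod_cast hCn
    have h2 : hfin.toFinset.card ≤ n := by omega
    exact (by exact_mod_cast h2 : (hfin.toFinset.card : ℝ) ≤ n).trans hny
  · have := Metric.isCover_iff_subset_iUnion_closedBall.1 hC hx
    simpa [Real.dist_eq] using this

lemma boxCovered_of_upperBoxDim_lt {t : ℝ≥0} {E : Set ℝ} (h : upperBoxDim E < t) :
    BoxCovered t E := by
  have h1 := eventually_lt_of_limsup_lt h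
  obtain ⟨δ, hδ, hδ'⟩ := (nhdsGT_basis (0 : ℝ≥0)).eventually_iff.1 h1
  have hδ2 : (0 : ℝ) < min (δ : ℝ) 1 / 2 := by
    have : (0 : ℝ) < δ := hδ
    positivity
  refine boxCovered_of_small t.2 (K := 1) hδ2 fun r hr hrδ => ?_
  lift r to ℝ≥0 using hr.le
  have hr' : 0 < r := by exact_mod_cast hr
  have hm : (0 : ℝ) < min (δ : ℝ) 1 := by linarith
  have hrlt : (r : ℝ) < min (δ : ℝ) 1 := by linarith
  have h2 := hδ' (x := r) ⟨hr', by exact_mod_cast hrlt.trans_le (min_le_left _ _)⟩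
  have h3 := (log_div_neg_log_le_iff hr' (by exact_mod_cast hrlt.trans_le (min_le_right _ _)) t).1 h2.le
  rw [one_mul]
  exact exists_finset_of_externalCoveringNumber_le (Real.rpow_nonneg hr.le _) h3

lemma upperBoxDim_le_of_boxCovered {t : ℝ≥0} {E : Set ℝ} (h : BoxCovered t E) :
    upperBoxDim E ≤ t := by
  obtain ⟨K, hK⟩ := h
  refine le_of_forall_gt_imp_ge_of_dense fun b hb => ?_
  induction b with
  | top => exact le_top
  | coe t' =>
  have htt : t < t' := by exact_mod_cast hb
  have hpos : (0 : ℝ) < t' - t := by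
    have : (t : ℝ) < t' := by exact_mod_cast htt
    linarith
  have hlim : Tendsto (fun r : ℝ≥0 => K * (r : ℝ) ^ ((t' : ℝ) - t)) (𝓝[>] 0) (𝓝 0) := by
    have h1 : Tendsto (fun r : ℝ≥0 => (r : ℝ)) (𝓝[>] 0) (𝓝 0) :=
      (NNReal.continuous_coe.tendsto' 0 0 rfl).mono_left nhdsWithin_le_nhds
    have h2 := (h1.rpow_const (p := (t' : ℝ) - t) (Or.inr hpos.le)).const_mul K
    rwa [Real.zero_rpow hpos.ne', mul_zero] at h2
  refine limsup_le_of_le (by isBoundedDefault) ?_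
  filter_upwards [hlim.eventually (gt_mem_nhds (zero_lt_one' ℝ)), self_mem_nhdsWithin,
    nhdsWithin_le_nhds (gt_mem_nhds (zero_lt_one' ℝ≥0))] with r hr1 hr2 hr3
  have hr2 : (0 : ℝ≥0) < r := hr2
  have hr0 : (0 : ℝ) < r := hr2
  rw [log_div_neg_log_le_iff hr2 hr3]
  obtain ⟨T, hT, hc⟩ := hK r hr0 (by exact_mod_cast hr3.le)
  have hcov : Metric.IsCover r E (T : Set ℝ) := by
    rw [Metric.isCover_iff_subset_iUnion_closedBall]
    intro x hx
    obtain ⟨y, hy, hxy⟩ := hc x hx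
    exact mem_biUnion (by exact_mod_cast hy) (by simpa [Real.dist_eq] using hxy)
  have hle : Metric.externalCoveringNumber r E ≤ (T.card : ℕ∞) := by
    simpa using hcov.externalCoveringNumber_le_encard
  calc ((Metric.externalCoveringNumber r E : ℕ∞) : ℝ≥0∞) ≤ ((T.card : ℕ∞) : ℝ≥0∞) := by
        exact_mod_cast hle
    _ = ENNReal.ofReal T.card := by simp
    _ ≤ _ := by
      refine ENNReal.ofReal_le_ofReal (hT.trans ?_)
      have : (r : ℝ) ^ (-(t : ℝ)) = (r : ℝ) ^ ((t' : ℝ) - t) * (r : ℝ) ^ (-(t' : ℝ)) := by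
        rw [← Real.rpow_add hr0]; congr 1; ring
      rw [this, ← mul_assoc]
      exact mul_le_of_le_one_left (Real.rpow_nonneg hr0.le _) hr1.le

/-- A maximal `r`-separated subset of `E` is both an `r`-cover of `E` and, with radii `r / 2`, a
packing of `E`, for which each ball contributes `r ^ s` to the sum. -/
lemma boxCovered_of_packingPre_ne_top {s : ℝ≥0} {E : Set ℝ} (h : packingPre s E ≠ ∞) :
    BoxCovered s E := by
  have h' : packingPre s E < ∞ := lt_top_iff_ne_top.2 h
  simp only [packingPre, iInf_lt_iff] at h'
  obtain ⟨δ, hδ, hlt⟩ := h'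
  set M := packingSup s δ E with hM
  refine boxCovered_of_small s.2 (K := M.toReal) hδ fun r hr hrδ => ?_
  lift r to ℝ≥0 using hr.le
  have hr' : 0 < r := by exact_mod_cast hr
  have hrs : (0 : ℝ) < (r : ℝ) ^ (s : ℝ) := Real.rpow_pos_of_pos hr _
  have hy : 0 ≤ M.toReal * (r : ℝ) ^ (-(s : ℝ)) :=
    mul_nonneg ENNReal.toReal_nonneg (Real.rpow_nonneg hr.le _)
  refine exists_finset_of_externalCoveringNumber_le hy ?_
  have hle : Metric.externalCoveringNumber r E ≤ ((⌊M.toReal * (r : ℝ) ^ (-(s : ℝ))⌋₊ : ℕ) : ℕ∞) := by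
    refine ((Metric.externalCoveringNumber_le_coveringNumber _ _).trans
      (Metric.coveringNumber_le_packingNumber _ _)).trans ?_
    refine iSup_le fun C => iSup_le fun hCE => iSup_le fun hC => ?_
    -- balls of radius `r / 2` around the points of an `r`-separated set form a packing
    have hP : IsPacking δ E ((fun x => (x, (r : ℝ) / 2)) '' C) := by
      refine ⟨?_, ?_, ?_, ?_⟩
      · rintro _ ⟨x, hx, rfl⟩; exact hCE hx
      · rintro _ ⟨x, hx, rfl⟩; exact half_pos hr
      · rintro _ ⟨x, hx, rfl⟩; exact (half_le_self hr.le).trans hrδ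
      · rintro _ ⟨x, hx, rfl⟩ _ ⟨y, hy, rfl⟩ hxy
        have hne : x ≠ y := fun h => hxy (by rw [h])
        have hsep : (r : ℝ≥0∞) < edist x y := hC hx hy hne
        rw [edist_dist, ← ENNReal.ofReal_coe_nnreal,
          ENNReal.ofReal_lt_ofReal_iff_of_nonneg hr.le] at hsep
        exact Metric.closedBall_disjoint_closedBall (by simpa using hsep)
    have hsum := le_iSup₂_of_le (f := fun (P : Set (ℝ × ℝ)) (_ : IsPacking δ E P) =>
      ∑' p : P, ENNReal.ofReal (2 * p.1.2) ^ (s : ℝ)) _ hP le_rfl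
    have hinj : Function.Injective (fun x : ℝ => (x, (r : ℝ) / 2)) := fun x y h => (Prod.ext_iff.1 h).1
    change _ ≤ M at hsum
    have hconst : ∀ p : ((fun x => (x, (r : ℝ) / 2)) '' C : Set (ℝ × ℝ)),
        ENNReal.ofReal (2 * p.1.2) ^ (s : ℝ) = ENNReal.ofReal ((r : ℝ) ^ (s : ℝ)) := by
      rintro ⟨_, x, hx, rfl⟩
      simp only
      rw [mul_div_cancel₀ _ (two_ne_zero), ENNReal.ofReal_rpow_of_pos hr]
    rw [tsum_congr hconst, ENNReal.tsum_const, ENat.card_coe_set_eq, hinj.encard_image] at hsum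
    have hfin : C.encard ≠ ⊤ := by
      intro htop
      rw [htop, ENat.toENNReal_top, ENNReal.top_mul (by simpa using hrs)] at hsum
      exact absurd hlt (not_lt.2 hsum)
    obtain ⟨n, hn⟩ := ENat.ne_top_iff_exists.1 hfin
    rw [← hn] at hsum ⊢
    have h2 := ENNReal.toReal_mono hlt.ne hsum
    rw [ENNReal.toReal_mul, ENNReal.toReal_ofReal hrs.le] at h2
    have h3 : (n : ℝ) ≤ M.toReal * (r : ℝ) ^ (-(s : ℝ)) := by
      rw [Real.rpow_neg hr.le, ← div_eq_mul_inv, le_div_iff₀ hrs]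
      simpa using h2
    exact_mod_cast Nat.le_floor h3
  calc ((Metric.externalCoveringNumber r E : ℕ∞) : ℝ≥0∞)
      ≤ (((⌊M.toReal * (r : ℝ) ^ (-(s : ℝ))⌋₊ : ℕ) : ℕ∞) : ℝ≥0∞) := by exact_mod_cast hle
    _ = ENNReal.ofReal (⌊M.toReal * (r : ℝ) ^ (-(s : ℝ))⌋₊ : ℕ) := by simp
    _ ≤ _ := ENNReal.ofReal_le_ofReal (Nat.floor_le hy)

/-- A packing of `E` has at most as many balls of radius greater than `ρ` as a cover of `E` by
intervals of radius `ρ` has members. -/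
lemma tsum_packing_le {δ : ℝ} {E : Set ℝ} {P : Set (ℝ × ℝ)} (hP : IsPacking δ E P) {ρ : ℝ}
    {T : Finset ℝ} (hT : ∀ x ∈ E, ∃ y ∈ T, |x - y| ≤ ρ) (c : ℝ≥0∞)
    (S : Set P) (hS : ∀ p ∈ S, ρ < p.1.2) :
    ∑' _ : S, c ≤ T.card * c := by
  have h1 : ∀ p : S, ∃ y : T, |p.1.1.1 - y.1| ≤ ρ := fun p => by
    obtain ⟨y, hy, h⟩ := hT _ (hP.center_mem _ p.1.2)
    exact ⟨⟨y, hy⟩, h⟩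
  choose φ hφ using h1
  have hinj : Function.Injective φ := by
    intro p q hpq
    by_contra hne
    have hne' : (p.1.1 : ℝ × ℝ) ≠ q.1.1 := fun h => hne (Subtype.ext (Subtype.ext h))
    have hd := hP.disjoint p.1.2 q.1.2 hne'
    have hp : (φ p : ℝ) ∈ Metric.closedBall p.1.1.1 p.1.1.2 := by
      rw [Metric.mem_closedBall, Real.dist_eq, abs_sub_comm]
      exact (hφ p).trans (hS _ p.2).le
    have hq : (φ p : ℝ) ∈ Metric.closedBall q.1.1.1 q.1.1.2 := by
      rw [Metric.mem_closedBall, Real.dist_eq, abs_sub_comm, hpq]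
      exact (hφ q).trans (hS _ q.2).le
    exact Set.disjoint_left.1 hd hp hq
  calc ∑' _ : S, c = ∑' p : S, (fun _ : T => c) (φ p) := rfl
    _ ≤ ∑' _ : T, c := ENNReal.tsum_comp_le_tsum_of_injective hinj _
    _ = T.card * c := by simp

/-- Sort the balls of a packing by the dyadic size of their radii: by `tsum_packing_le`, those of
radius about `2 ^ (-n)` contribute `O(2 ^ (n * (t - s)))`, and for a `2 ^ (-M)`-packing only the
tail `n ≥ M` of this geometric series occurs. -/
lemma packingPre_eq_zero_of_boxCovered {t : ℝ} {s : ℝ≥0} {E : Set ℝ} (h : BoxCovered t E)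
    (hts : t < s) : packingPre s E = 0 := by
  obtain ⟨K, hK⟩ := h
  set q : ℝ := (1 / 2 : ℝ) ^ ((s : ℝ) - t) with hq
  have hq0 : 0 < q := Real.rpow_pos_of_pos (by norm_num) _
  have hq1 : q < 1 := Real.rpow_lt_one (by norm_num) (by norm_num) (by linarith)
  set K' : ℝ := K * 2 ^ (t + s) with hK'
  have hbound : ∀ M : ℕ, packingPre s E ≤ ENNReal.ofReal (K' * (1 - q)⁻¹ * q ^ M) := by
    intro M
    refine (iInf₂_le ((1 / 2 : ℝ) ^ M) (by positivity)).trans ?_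
    refine iSup₂_le fun P hP => ?_
    have hn : ∀ p : P, ∃ j : ℕ, (1 / 2 : ℝ) ^ (M + j + 1) < p.1.2 ∧ p.1.2 ≤ (1 / 2) ^ (M + j) := by
      intro p
      have hle := hP.radius_le _ p.2
      obtain ⟨n, h1, h2⟩ := exists_nat_pow_near_of_lt_one (hP.radius_pos _ p.2)
        (hle.trans (pow_le_one₀ (by norm_num) (by norm_num))) (y := (1 / 2 : ℝ)) (by norm_num)
        (by norm_num)
      have hMn : M < n + 1 := (pow_lt_pow_iff_right_of_lt_one₀ (by norm_num : (0 : ℝ) < 1 / 2)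
        (by norm_num)).1 (h1.trans_le hle)
      refine ⟨n - M, ?_, ?_⟩ <;> rw [Nat.add_sub_cancel' (by omega)] <;> assumption
    choose j hj1 hj2 using hn
    have hterm : ∀ n : ℕ, ∑' p : {p : P | j p = n}, ENNReal.ofReal (2 * p.1.1.2) ^ (s : ℝ) ≤
        ENNReal.ofReal (K' * q ^ M * q ^ n) := by
      intro n
      have hx0 : (0 : ℝ) < (1 / 2) ^ (M + n) := by positivity
      obtain ⟨T, hT, hc⟩ := hK ((1 / 2) ^ (M + n + 1)) (by positivity)
        (pow_le_one₀ (by norm_num) (by norm_num))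
      calc ∑' p : {p : P | j p = n}, ENNReal.ofReal (2 * p.1.1.2) ^ (s : ℝ)
          ≤ ∑' _ : {p : P | j p = n}, ENNReal.ofReal (2 * (1 / 2) ^ (M + n)) ^ (s : ℝ) := by
            refine ENNReal.tsum_le_tsum fun p => ?_
            have hp := hj2 p.1
            rw [show j p.1 = n from p.2] at hp
            gcongr
        _ ≤ T.card * ENNReal.ofReal (2 * (1 / 2) ^ (M + n)) ^ (s : ℝ) := by
            refine tsum_packing_le hP hc _ _ fun p hp => ?_
            have h1 := hj1 p
            rwa [show j p = n from hp] at h1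
        _ = ENNReal.ofReal (T.card * (2 * (1 / 2) ^ (M + n)) ^ (s : ℝ)) := by
            rw [ENNReal.ofReal_rpow_of_pos (by positivity), ENNReal.ofReal_mul (by positivity)]
            simp
        _ ≤ ENNReal.ofReal (K' * q ^ M * q ^ n) := by
            refine ENNReal.ofReal_le_ofReal ?_
            have hx : K * ((1 / 2 : ℝ) ^ (M + n + 1)) ^ (-t) * (2 * (1 / 2) ^ (M + n)) ^ (s : ℝ)
                = K' * q ^ M * q ^ n := by
              have e1 : ((1 / 2 : ℝ) ^ (M + n + 1)) = (1 / 2) ^ (M + n) * 2⁻¹ := by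
                rw [pow_succ]; norm_num
              have e2 : q ^ M * q ^ n = ((1 / 2 : ℝ) ^ (M + n)) ^ ((s : ℝ) - t) := by
                rw [← pow_add, hq, ← Real.rpow_natCast, ← Real.rpow_mul (by norm_num), mul_comm,
                  Real.rpow_mul (by norm_num), Real.rpow_natCast]
              rw [mul_assoc K', e2, e1, Real.mul_rpow hx0.le (by norm_num),
                Real.mul_rpow (by norm_num) hx0.le, hK', Real.rpow_add (by norm_num),
                Real.rpow_sub hx0, Real.rpow_neg hx0.le, Real.inv_rpow (by norm_num),
                Real.rpow_neg (by norm_num : (0:ℝ) ≤ 2), inv_inv]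
              ring
            rw [← hx]
            exact mul_le_mul_of_nonneg_right hT (by positivity)
    calc ∑' p : P, ENNReal.ofReal (2 * p.1.2) ^ (s : ℝ)
        = ∑' n : ℕ, ∑' p : {p : P | j p = n}, ENNReal.ofReal (2 * p.1.1.2) ^ (s : ℝ) := by
          rw [← ENNReal.tsum_sigma,
            ← (Equiv.sigmaFiberEquiv j).tsum_eq]
          rfl
      _ ≤ ∑' n : ℕ, ENNReal.ofReal (K' * q ^ M * q ^ n) := ENNReal.tsum_le_tsum hterm
      _ = ENNReal.ofReal (∑' n : ℕ, K' * q ^ M * q ^ n) := by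
          have hK0 : 0 ≤ K' := by
            obtain ⟨T, hT, -⟩ := hK 1 one_pos le_rfl
            rw [Real.one_rpow, mul_one] at hT
            exact mul_nonneg ((Nat.cast_nonneg _).trans hT) (by positivity)
          rw [ENNReal.ofReal_tsum_of_nonneg (fun n => by positivity)
            ((summable_geometric_of_lt_one hq0.le hq1).mul_left _)]
      _ = ENNReal.ofReal (K' * (1 - q)⁻¹ * q ^ M) := by
          rw [tsum_mul_left, tsum_geometric_of_lt_one hq0.le hq1]; ring_nf
  have hlim : Tendsto (fun M : ℕ => ENNReal.ofReal (K' * (1 - q)⁻¹ * q ^ M)) atTop (𝓝 0) := by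
    have := ENNReal.tendsto_ofReal
      ((tendsto_pow_atTop_nhds_zero_of_lt_one hq0.le hq1).const_mul (K' * (1 - q)⁻¹))
    simpa using this
  exact le_antisymm (ge_of_tendsto' hlim hbound) bot_le

lemma packingMeasure_eq_zero_of_countable {ι : Type*} [Countable ι] [Nonempty ι] {s : ℝ≥0} {E : Set ℝ}
    (F : ι → Set ℝ) (hE : E ⊆ ⋃ i, F i) (hF : ∀ i, packingPre s (F i) = 0) :
    packingMeasure s E = 0 := by
  obtain ⟨e, he⟩ := exists_surjective_nat ι
  refine le_antisymm ?_ bot_le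
  refine (iInf₂_le (fun n => F (e n)) ?_).trans (by simp [hF])
  exact hE.trans (he.iUnion_comp F).ge

/-! ### Covers of self-similar sets -/

/-- A self-similar recursion. At scale `ρ`, the pieces `g i '' Y` with `l i ≤ ρ / 2` lie close to the
points `g i 0`, and the finitely many others are copies of `Y` seen at the larger scale `ρ / l i`. -/
lemma boxCovered_of_subset_iUnion_image {ι : Type*} {t : ℝ} (ht : 0 < t) {Y : Set ℝ}
    (hY : Y ⊆ Icc 0 1) (g : ι → ℝ → ℝ) (l : ι → ℝ) (hl0 : ∀ i, 0 < l i) (hl1 : ∀ i, l i ≤ 1 / 2)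
    (hg : ∀ i x y, |g i x - g i y| ≤ l i * |x - y|)
    (hfin : ∀ r, 0 < r → {i | r < l i}.Finite)
    (hsum : ∀ B : Finset ι, ∑ i ∈ B, l i ^ t ≤ 1 / 2)
    (hsub : Y ⊆ ⋃ i, g i '' Y) (h0 : BoxCovered t (range fun i => g i 0)) :
    BoxCovered t Y := by
  classical
  obtain ⟨K₀, hK₀⟩ := h0
  -- `2 ^ t` serves the scales in `[1, 2]`, where one interval is enough; `2 * K₀ * 2 ^ t` makes the
  -- cover of the points `g i 0` at scale `ρ / 2` use at most half of the bound
  set K : ℝ := max (2 ^ t) (2 * K₀ * 2 ^ t) with hKdef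
  have hKpos : 0 < K := lt_of_lt_of_le (by positivity) (le_max_left _ _)
  have main : ∀ n : ℕ, ∀ ρ : ℝ, (1 / 2 : ℝ) ^ n ≤ ρ → ρ ≤ 2 →
      ∃ T : Finset ℝ, (T.card : ℝ) ≤ K * ρ ^ (-t) ∧ ∀ x ∈ Y, ∃ y ∈ T, |x - y| ≤ ρ := by
    have large : ∀ ρ : ℝ, 1 ≤ ρ → ρ ≤ 2 →
        ∃ T : Finset ℝ, (T.card : ℝ) ≤ K * ρ ^ (-t) ∧ ∀ x ∈ Y, ∃ y ∈ T, |x - y| ≤ ρ := by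
      intro ρ hρ1 hρ2
      have hρ0 : 0 < ρ := by linarith
      refine ⟨{0}, ?_, fun x hx => ⟨0, by simp, ?_⟩⟩
      · have h1 : ρ ^ t ≤ 2 ^ t := Real.rpow_le_rpow hρ0.le hρ2 ht.le
        rw [Real.rpow_neg hρ0.le, ← div_eq_mul_inv, le_div_iff₀ (by positivity)]
        rw [Finset.card_singleton, Nat.cast_one, one_mul]
        exact h1.trans (le_max_left _ _)
      · rw [sub_zero, abs_of_nonneg (hY hx).1]
        exact (hY hx).2.trans hρ1
    intro n
    induction n with
    | zero =>
      intro ρ hρ hρ2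
      exact large ρ (by simpa using hρ) hρ2
    | succ n ih =>
      intro ρ hρ hρ2
      rcases le_or_gt 1 ρ with hρ1 | hρ1
      · exact large ρ hρ1 hρ2
      have hρ0 : 0 < ρ := lt_of_lt_of_le (by positivity) hρ
      obtain ⟨T₀, hT₀, hc₀⟩ := hK₀ (ρ / 2) (by linarith) (by linarith)
      set B : Finset ι := (hfin (ρ / 2) (by linarith)).toFinset with hB
      have hBmem : ∀ i, i ∈ B ↔ ρ / 2 < l i := fun i => by simp [hB]
      have hT : ∀ i : ι, ∃ T : Finset ℝ, i ∈ B → (T.card : ℝ) ≤ K * (ρ / l i) ^ (-t) ∧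
          ∀ x ∈ Y, ∃ y ∈ T, |x - y| ≤ ρ / l i := by
        intro i
        by_cases hi : i ∈ B
        · have hi' := (hBmem i).1 hi
          have hlow : (1 / 2 : ℝ) ^ n ≤ ρ / l i := by
            rw [le_div_iff₀ (hl0 i)]
            calc (1 / 2 : ℝ) ^ n * l i ≤ (1 / 2 : ℝ) ^ n * (1 / 2) := by gcongr; exact hl1 i
              _ = (1 / 2 : ℝ) ^ (n + 1) := (pow_succ _ _).symm
              _ ≤ ρ := hρ
          have hup : ρ / l i ≤ 2 := by
            rw [div_le_iff₀ (hl0 i)]; linarith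
          obtain ⟨T, hT⟩ := ih (ρ / l i) hlow hup
          exact ⟨T, fun _ => hT⟩
        · exact ⟨∅, fun h => (hi h).elim⟩
      choose T hT using hT
      refine ⟨T₀ ∪ B.biUnion fun i => (T i).image (g i), ?_, ?_⟩
      · have hρt : 0 < ρ ^ (-t) := Real.rpow_pos_of_pos hρ0 _
        have h1 : ((B.biUnion fun i => (T i).image (g i)).card : ℝ) ≤ K * ρ ^ (-t) * (1 / 2) := by
          calc ((B.biUnion fun i => (T i).image (g i)).card : ℝ)
              ≤ ∑ i ∈ B, (((T i).image (g i)).card : ℝ) := by exact_mod_cast Finset.card_biUnion_le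
            _ ≤ ∑ i ∈ B, K * ρ ^ (-t) * l i ^ t := by
              refine Finset.sum_le_sum fun i hi => ?_
              calc (((T i).image (g i)).card : ℝ) ≤ (T i).card := by
                    exact_mod_cast Finset.card_image_le
                _ ≤ K * (ρ / l i) ^ (-t) := (hT i hi).1
                _ = K * ρ ^ (-t) * l i ^ t := by
                  rw [Real.div_rpow hρ0.le (hl0 i).le, Real.rpow_neg (hl0 i).le, div_inv_eq_mul,
                    mul_assoc]
            _ = K * ρ ^ (-t) * ∑ i ∈ B, l i ^ t := by rw [Finset.mul_sum]
            _ ≤ _ := by gcongr; exact hsum B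
        have h2 : (T₀.card : ℝ) ≤ K * ρ ^ (-t) * (1 / 2) := by
          refine hT₀.trans ?_
          rw [Real.div_rpow hρ0.le (by norm_num), Real.rpow_neg (by norm_num : (0 : ℝ) ≤ 2),
            div_inv_eq_mul]
          have h3 : 2 * K₀ * 2 ^ t ≤ K := le_max_right _ _
          nlinarith
        calc ((T₀ ∪ B.biUnion fun i => (T i).image (g i)).card : ℝ)
            ≤ T₀.card + (B.biUnion fun i => (T i).image (g i)).card := by
              exact_mod_cast Finset.card_union_le _ _
          _ ≤ K * ρ ^ (-t) := by linarith
      · intro x hx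
        obtain ⟨i, y, hy, rfl⟩ := mem_iUnion.1 (hsub hx)
        by_cases hi : i ∈ B
        · obtain ⟨z, hz, hyz⟩ := (hT i hi).2 y hy
          refine ⟨g i z, Finset.mem_union_right _
            (Finset.mem_biUnion.2 ⟨i, hi, Finset.mem_image_of_mem _ hz⟩), (hg i y z).trans ?_⟩
          calc l i * |y - z| ≤ l i * (ρ / l i) := by gcongr; exact (hl0 i).le
            _ = ρ := mul_div_cancel₀ _ (hl0 i).ne'
        · rw [hBmem, not_lt] at hi
          obtain ⟨z, hz, h0z⟩ := hc₀ _ ⟨i, rfl⟩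
          refine ⟨z, Finset.mem_union_left _ hz, ?_⟩
          have h1 : |g i y - g i 0| ≤ ρ / 2 := by
            refine (hg i y 0).trans ?_
            rw [sub_zero, abs_of_nonneg (hY hy).1]
            have := (hY hy).2
            have := (hl0 i).le
            nlinarith
          have := abs_sub_le (g i y) (g i 0) z
          linarith
  refine ⟨K, fun r hr hr1 => ?_⟩
  obtain ⟨n, hn⟩ := exists_pow_lt_of_lt_one hr (by norm_num : (1 / 2 : ℝ) < 1)
  exact main n r hn.le (by linarith)

/-! ### The coding map of a decaying system -/

variable {d : ℝ} {f : ℕ+ → ℝ → ℝ}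

lemma comp_add (f : ℕ+ → ℝ → ℝ) (a : ℕ → ℕ+) (k n : ℕ) :
    comp f a (k + n) = comp f a k ∘ comp f (fun i => a (k + i)) n := by
  induction n with
  | zero => rfl
  | succ n ih =>
    rw [← add_assoc, comp, ih]
    rfl

lemma comp_congr (f : ℕ+ → ℝ → ℝ) {a b : ℕ → ℕ+} {n : ℕ} (h : ∀ i < n, a i = b i) :
    comp f a n = comp f b n := by
  induction n with
  | zero => rfl
  | succ n ih =>
    rw [comp, comp, ih fun i hi => h i (by omega), h n (by omega)]

/-- The mean value theorem, with the derivative within `[0, 1]`. -/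
lemma exists_abs_sub_eq {g : ℝ → ℝ} (hg : DifferentiableOn ℝ g (Icc 0 1)) {x y : ℝ}
    (hx : x ∈ Icc (0 : ℝ) 1) (hy : y ∈ Icc (0 : ℝ) 1) :
    ∃ z ∈ Icc (0 : ℝ) 1, |g x - g y| = |derivWithin g (Icc 0 1) z| * |x - y| := by
  wlog hxy : x ≤ y generalizing x y
  · obtain ⟨z, hz, h⟩ := this hy hx (le_of_not_ge hxy)
    exact ⟨z, hz, by rw [abs_sub_comm, h, abs_sub_comm y]⟩
  rcases hxy.eq_or_lt with rfl | hlt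
  · exact ⟨x, hx, by simp⟩
  have hsub : Icc x y ⊆ Icc (0 : ℝ) 1 := Icc_subset_Icc hx.1 hy.2
  obtain ⟨z, hz, h⟩ := exists_deriv_eq_slope g hlt (hg.continuousOn.mono hsub)
    fun w hw => ((hg.differentiableAt (Icc_mem_nhds (hx.1.trans_lt hw.1)
      (hw.2.trans_le hy.2)))).differentiableWithinAt
  refine ⟨z, hsub (Ioo_subset_Icc_self hz), ?_⟩
  rw [derivWithin_of_mem_nhds (Icc_mem_nhds (hx.1.trans_lt hz.1) (hz.2.trans_le hy.2)), h,
    abs_div, abs_sub_comm x y, div_mul_cancel₀ _ (abs_pos.2 (sub_pos.2 hlt).ne').ne',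
    abs_sub_comm]

namespace IsDecaying

lemma pos (hf : IsDecaying d f) : 0 < d := one_pos.trans hf.one_lt

lemma differentiableOn (hf : IsDecaying d f) (i : ℕ+) : DifferentiableOn ℝ (f i) (Icc 0 1) :=
  (hf.contDiffOn i).differentiableOn one_ne_zero

lemma exists_abs_sub_le (hf : IsDecaying d f) {τ : ℝ} (hτ : 1 / d < τ) :
    ∃ C : ℝ, 0 < C ∧ ∀ (i : ℕ+), ∀ x ∈ Icc (0 : ℝ) 1, ∀ y ∈ Icc (0 : ℝ) 1,
      |f i x - f i y| ≤ C / (i : ℝ) ^ (1 / τ) * |x - y| := by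
  have hd := hf.pos
  -- the decay condition with `d - ε = 1 / τ`
  have hε : 0 < d - 1 / τ := sub_pos.2 ((one_div_lt hd ((by positivity : 0 < 1 / d).trans hτ)).1 hτ)
  obtain ⟨_, C, _, hC, h⟩ := hf.decay _ hε
  refine ⟨C, hC, fun i x hx y hy => ?_⟩
  obtain ⟨ξ, l, hb, -, -, hl⟩ := h i
  obtain ⟨z, hz, he⟩ := exists_abs_sub_eq (hf.differentiableOn i) hx hy
  rw [sub_sub_cancel] at hl
  rw [he]
  exact mul_le_mul_of_nonneg_right ((hb z hz).2.trans hl) (abs_nonneg _)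

lemma exists_le_abs_sub (hf : IsDecaying d f) {τ : ℝ} (hτ0 : 0 < τ) (hτ : τ < 1 / d) :
    ∃ c : ℝ, 0 < c ∧ ∀ (i : ℕ+), ∀ x ∈ Icc (0 : ℝ) 1, ∀ y ∈ Icc (0 : ℝ) 1,
      c / (i : ℝ) ^ (1 / τ) * |x - y| ≤ |f i x - f i y| := by
  -- the decay condition with `d + ε = 1 / τ`
  have hε : 0 < 1 / τ - d := sub_pos.2 ((lt_one_div hτ0 hf.pos).1 hτ)
  obtain ⟨c, _, hc, _, h⟩ := hf.decay _ hε
  refine ⟨c, hc, fun i x hx y hy => ?_⟩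
  obtain ⟨ξ, l, hb, hξ, -, -⟩ := h i
  obtain ⟨z, hz, he⟩ := exists_abs_sub_eq (hf.differentiableOn i) hx hy
  rw [add_sub_cancel] at hξ
  rw [he]
  exact mul_le_mul_of_nonneg_right (hξ.trans (hb z hz).1) (abs_nonneg _)

lemma comp_mapsTo (hf : IsDecaying d f) (a : ℕ → ℕ+) (n : ℕ) :
    MapsTo (comp f a n) (Icc 0 1) (Icc 0 1) := by
  induction n with
  | zero => exact mapsTo_id _
  | succ n ih => exact ih.comp (hf.mapsTo _)

lemma comp_differentiableOn (hf : IsDecaying d f) (a : ℕ → ℕ+) (n : ℕ) :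
    DifferentiableOn ℝ (comp f a n) (Icc 0 1) := by
  induction n with
  | zero => exact differentiableOn_id
  | succ n ih => exact ih.comp (hf.differentiableOn _) (hf.mapsTo _)

lemma comp_bilipschitz (hf : IsDecaying d f) (a : ℕ → ℕ+) (n : ℕ) :
    ∃ L : ℝ, 1 ≤ L ∧ ∀ x ∈ Icc (0 : ℝ) 1, ∀ y ∈ Icc (0 : ℝ) 1,
      |comp f a n x - comp f a n y| ≤ L * |x - y| ∧
      |x - y| ≤ L * |comp f a n x - comp f a n y| := by
  induction n with
  | zero => exact ⟨1, le_rfl, fun x _ y _ => by simp [comp]⟩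
  | succ n ih =>
    obtain ⟨L, hL, h⟩ := ih
    have hd : 0 < 1 / d := one_div_pos.2 hf.pos
    obtain ⟨C, hC, hC'⟩ := hf.exists_abs_sub_le (τ := 2 * (1 / d)) (by linarith)
    obtain ⟨c, hc, hc'⟩ := hf.exists_le_abs_sub (τ := 1 / d / 2) (by linarith) (by linarith)
    have hi : ∀ p : ℝ, 0 < ((a n : ℕ) : ℝ) ^ p := fun p => Real.rpow_pos_of_pos (by simp) _
    set U := C / (a n : ℝ) ^ (1 / (2 * (1 / d)))
    set V := c / (a n : ℝ) ^ (1 / (1 / d / 2))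
    have hU : 0 < U := div_pos hC (hi _)
    have hV : 0 < V := div_pos hc (hi _)
    refine ⟨L * (1 + U + V⁻¹), ?_, fun x hx y hy => ?_⟩
    · have : 0 < V⁻¹ := inv_pos.2 hV
      nlinarith
    · obtain ⟨h1, h2⟩ := h _ (hf.mapsTo (a n) hx) _ (hf.mapsTo (a n) hy)
      have h3 := hC' (a n) x hx y hy
      have h4 : |x - y| ≤ V⁻¹ * |f (a n) x - f (a n) y| := by
        rw [← div_eq_inv_mul, le_div_iff₀' hV]
        exact hc' (a n) x hx y hy
      have hV' : 0 < V⁻¹ := inv_pos.2 hV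
      constructor
      · calc |comp f a (n + 1) x - comp f a (n + 1) y| ≤ L * |f (a n) x - f (a n) y| := h1
          _ ≤ L * (U * |x - y|) := by gcongr
          _ ≤ L * ((1 + U + V⁻¹) * |x - y|) := by gcongr; linarith
          _ = _ := by ring
      · calc |x - y| ≤ V⁻¹ * |f (a n) x - f (a n) y| := h4
          _ ≤ V⁻¹ * (L * |comp f a (n + 1) x - comp f a (n + 1) y|) := by gcongr; exact h2
          _ ≤ (1 + U + V⁻¹) * (L * |comp f a (n + 1) x - comp f a (n + 1) y|) := by
            gcongr; linarith
          _ = _ := by ring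

/-- The cylinders of level `n` shrink to points, uniformly in the digits. -/
lemma exists_contraction (hf : IsDecaying d f) :
    ∃ δ : ℕ → ℝ, Tendsto δ atTop (𝓝 0) ∧ ∀ (a : ℕ → ℕ+) (n : ℕ),
      ∀ x ∈ Icc (0 : ℝ) 1, ∀ y ∈ Icc (0 : ℝ) 1, |comp f a n x - comp f a n y| ≤ δ n := by
  obtain ⟨m, hm, A, hA0, hA1, hA⟩ := hf.contracting
  have hblock : ∀ k, ∀ a : ℕ → ℕ+, ∀ x ∈ Icc (0 : ℝ) 1, ∀ y ∈ Icc (0 : ℝ) 1,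
      |comp f a (m * k) x - comp f a (m * k) y| ≤ A ^ k := by
    intro k
    induction k with
    | zero =>
      intro a x hx y hy
      simpa [comp] using abs_sub_le_of_le_of_le hx.1 hx.2 hy.1 hy.2
    | succ k ih =>
      intro a x hx y hy
      rw [mul_add, mul_one, add_comm, comp_add]
      obtain ⟨z, hz, he⟩ := exists_abs_sub_eq (hf.comp_differentiableOn a m)
        (hf.comp_mapsTo (fun i => a (m + i)) (m * k) hx)
        (hf.comp_mapsTo (fun i => a (m + i)) (m * k) hy)
      rw [Function.comp_apply, Function.comp_apply, he, pow_succ']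
      exact mul_le_mul (hA a z hz).2 (ih _ x hx y hy) (abs_nonneg _) hA0.le
  refine ⟨fun n => A ^ (n / m), (tendsto_pow_atTop_nhds_zero_of_lt_one hA0.le hA1).comp
    (Nat.tendsto_div_const_atTop (by omega)), fun a n x hx y hy => ?_⟩
  rw [← Nat.div_add_mod n m, comp_add]
  refine (hblock _ a _ (hf.comp_mapsTo _ _ hx) _ (hf.comp_mapsTo _ _ hy)).trans_eq ?_
  rw [Nat.div_add_mod]

end IsDecaying

/-- The point `Π(a)` with digit sequence `a`. -/
def codingPoint (f : ℕ+ → ℝ → ℝ) (a : ℕ → ℕ+) : ℝ := limUnder atTop fun n => comp f a n 1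

namespace IsDecaying

lemma isCoding_codingPoint (hf : IsDecaying d f) (a : ℕ → ℕ+) : IsCoding f a (codingPoint f a) := by
  obtain ⟨δ, hδ, h⟩ := hf.exists_contraction
  have h1 : (1 : ℝ) ∈ Icc (0 : ℝ) 1 := ⟨zero_le_one, le_rfl⟩
  have hc : CauchySeq fun n => comp f a n 1 := by
    refine cauchySeq_of_le_tendsto_0 δ (fun n m N hn hm => ?_) hδ
    obtain ⟨n, rfl⟩ := Nat.exists_eq_add_of_le hn
    obtain ⟨m, rfl⟩ := Nat.exists_eq_add_of_le hm
    rw [comp_add, comp_add, Real.dist_eq]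
    exact h a N _ (hf.comp_mapsTo _ _ h1) _ (hf.comp_mapsTo _ _ h1)
  exact hc.tendsto_limUnder

lemma codingPoint_mem (hf : IsDecaying d f) (a : ℕ → ℕ+) : codingPoint f a ∈ Icc (0 : ℝ) 1 :=
  isClosed_Icc.mem_of_tendsto (hf.isCoding_codingPoint a)
    (Eventually.of_forall fun n => hf.comp_mapsTo a n ⟨zero_le_one, le_rfl⟩)

lemma isCoding_iff (hf : IsDecaying d f) {a : ℕ → ℕ+} {x : ℝ} :
    IsCoding f a x ↔ x = codingPoint f a :=
  ⟨fun h => tendsto_nhds_unique h (hf.isCoding_codingPoint a),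
    fun h => h ▸ hf.isCoding_codingPoint a⟩

lemma codingPoint_eq_comp (hf : IsDecaying d f) (a : ℕ → ℕ+) (k : ℕ) :
    codingPoint f a = comp f a k (codingPoint f fun i => a (k + i)) := by
  have hmem := hf.codingPoint_mem fun i => a (k + i)
  have h1 : Tendsto (fun n => comp f (fun i => a (k + i)) n 1) atTop
      (𝓝[Icc 0 1] codingPoint f fun i => a (k + i)) :=
    tendsto_nhdsWithin_iff.2 ⟨hf.isCoding_codingPoint _,
      Eventually.of_forall fun n => hf.comp_mapsTo _ n ⟨zero_le_one, le_rfl⟩⟩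
  have h2 := ((hf.comp_differentiableOn a k).continuousOn _ hmem).tendsto.comp h1
  have h3 := (tendsto_add_atTop_iff_nat k).2 (hf.isCoding_codingPoint a)
  refine tendsto_nhds_unique h3 (h2.congr fun n => ?_)
  rw [add_comm n k, comp_add]
  rfl

lemma codingPoint_eq_apply (hf : IsDecaying d f) (a : ℕ → ℕ+) :
    codingPoint f a = f (a 0) (codingPoint f fun i => a (i + 1)) := by
  rw [hf.codingPoint_eq_comp a 1]
  simp only [add_comm 1]
  rfl

lemma continuous_codingPoint (hf : IsDecaying d f) : Continuous (codingPoint f) := by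
  obtain ⟨δ, hδ, h⟩ := hf.exists_contraction
  rw [continuous_iff_continuousAt]
  intro a
  rw [ContinuousAt, Metric.tendsto_nhds]
  intro ε hε
  obtain ⟨n, hn⟩ := (hδ.eventually (gt_mem_nhds hε)).exists
  have hcyl : ∀ᶠ b in 𝓝 a, ∀ i ∈ Finset.range n, b i = a i := by
    rw [Filter.eventually_all_finset]
    intro i _
    have hi : Tendsto (fun b : ℕ → ℕ+ => b i) (𝓝 a) (𝓝 (a i)) := (continuous_apply i).continuousAt
    rw [nhds_discrete ℕ+] at hi
    exact tendsto_pure.1 hi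
  filter_upwards [hcyl] with b hb
  rw [Real.dist_eq, hf.codingPoint_eq_comp b n, hf.codingPoint_eq_comp a n,
    comp_congr f fun i hi => hb i (Finset.mem_range.2 hi)]
  exact (h a n _ (hf.codingPoint_mem _) _ (hf.codingPoint_mem _)).trans_lt hn

end IsDecaying

/-! ### Points with large digits and the upper bound -/

/-- The points that have a digit sequence with all digits at least `k`. -/
def tailSet (f : ℕ+ → ℝ → ℝ) (k : ℕ+) : Set ℝ :=
  {x | ∃ a : ℕ → ℕ+, (∀ n, k ≤ a n) ∧ IsCoding f a x}

namespace IsDecaying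

lemma tailSet_subset_Icc (hf : IsDecaying d f) (k : ℕ+) : tailSet f k ⊆ Icc 0 1 := by
  rintro x ⟨a, -, ha⟩
  rw [hf.isCoding_iff.1 ha]
  exact hf.codingPoint_mem a

/-- Tail sets are self-similar: `tailSet f k ⊆ ⋃ b ≥ k, f b '' tailSet f k`. Since `1 / d < t`, the
Lipschitz constants of the maps `f b` have a convergent sum of `t`-th powers, so for large `k` the
recursion `boxCovered_of_subset_iUnion_image` applies. -/
lemma exists_boxCovered_tailSet (hf : IsDecaying d f) {t : ℝ} (ht : 1 / d < t)
    (h0 : BoxCovered t (range fun i : ℕ+ => f i 0)) :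
    ∃ k, BoxCovered t (tailSet f k) := by
  have hd : 0 < 1 / d := one_div_pos.2 hf.pos
  have ht0 : 0 < t := hd.trans ht
  obtain ⟨τ, hτ1, hτ2⟩ := exists_between ht
  have hτ0 : 0 < τ := hd.trans hτ1
  obtain ⟨C, hC, hlip⟩ := hf.exists_abs_sub_le hτ1
  set l : ℕ+ → ℝ := fun i => C / (i : ℝ) ^ (1 / τ) with hl
  have hlpos : ∀ i, 0 < l i := fun i => div_pos hC (Real.rpow_pos_of_pos (by simp) _)
  have hsum : Summable fun i => l i ^ t := by
    have h1 : Summable fun n : ℕ => 1 / (n : ℝ) ^ (1 / τ * t) := by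
      rw [Real.summable_one_div_nat_rpow, one_div_mul_eq_div, one_lt_div hτ0]
      exact hτ2
    refine ((h1.comp_injective PNat.coe_injective).mul_left (C ^ t)).congr fun i => ?_
    rw [hl, Real.div_rpow hC.le (Real.rpow_nonneg (by simp) _), ← Real.rpow_mul (by simp)]
    simp [div_eq_mul_inv]
  obtain ⟨s, hs⟩ := summable_iff_vanishing_norm.1 hsum (min (1 / 2) ((1 / 2) ^ t)) (by positivity)
  obtain ⟨M, hM⟩ := s.bddAbove
  -- beyond `M`, the sums are so small that also every single constant is at most `1 / 2`
  have hk : ∀ B : Finset {b : ℕ+ // M + 1 ≤ b},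
      ∑ i ∈ B, l i ^ t < min (1 / 2) ((1 / 2) ^ t) := by
    intro B
    have h1 := hs (B.map (Function.Embedding.subtype _)) (by
      rw [Finset.disjoint_left]
      intro i hi his
      obtain ⟨j, -, rfl⟩ := Finset.mem_map.1 hi
      exact absurd (j.2.trans (hM his)) (not_le.2 (PNat.lt_add_right M 1)))
    rw [Finset.sum_map] at h1
    exact (le_abs_self _).trans_lt h1
  -- precomposing with the projection to `[0, 1]` makes the maps Lipschitz on the whole line
  refine ⟨M + 1, boxCovered_of_subset_iUnion_image (ι := {b : ℕ+ // M + 1 ≤ b}) ht0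
    (hf.tailSet_subset_Icc _) (fun i x => f i (projIcc 0 1 zero_le_one x)) (fun i => l i)
    (fun i => hlpos i) ?_ ?_ ?_ ?_ ?_ ?_⟩
  · intro i
    have h1 := (hk {i}).trans_le (min_le_right _ _)
    rw [Finset.sum_singleton] at h1
    exact ((Real.rpow_lt_rpow_iff (hlpos i).le (by norm_num) ht0).1 h1).le
  · intro i x y
    refine (hlip i _ (projIcc 0 1 zero_le_one x).2 _ (projIcc 0 1 zero_le_one y).2).trans ?_
    exact mul_le_mul_of_nonneg_left (abs_projIcc_sub_projIcc zero_le_one) (hlpos i).le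
  · intro r hr
    have h1 := hsum.tendsto_cofinite_zero.eventually (gt_mem_nhds (Real.rpow_pos_of_pos hr t))
    have h2 : {i : ℕ+ | r < l i}.Finite := by
      refine (eventually_cofinite.1 h1).subset fun i hi => ?_
      exact not_lt.2 (Real.rpow_le_rpow hr.le (le_of_lt hi) ht0.le)
    exact h2.preimage (f := (Subtype.val : {b : ℕ+ // M + 1 ≤ b} → ℕ+)) Subtype.val_injective.injOn
  · exact fun B => ((hk B).trans_le (min_le_left _ _)).le
  · rintro x ⟨a, ha, hx⟩
    rw [hf.isCoding_iff.1 hx, hf.codingPoint_eq_apply]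
    refine mem_iUnion.2 ⟨⟨a 0, ha 0⟩, _, ⟨_, fun n => ha (n + 1), hf.isCoding_codingPoint _⟩, ?_⟩
    dsimp only
    rw [projIcc_of_mem _ (hf.codingPoint_mem _)]
  · refine h0.mono ?_
    rintro _ ⟨i, rfl⟩
    exact ⟨i, by simp [projIcc_left]⟩

/-- As `Φ n ≥ n`, the digits increase strictly, so that those after the `k`-th exceed `k`. A word of
length `k` is continued by the digit `1`, which does not matter for `comp`. -/
lemma growthSet_subset (hf : IsDecaying d f) {Φ : ℕ+ → ℝ} (hΦ : ∀ n : ℕ+, (n : ℝ) ≤ Φ n) (k : ℕ+) :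
    growthSet f Φ ⊆ ⋃ w : Fin k → ℕ+,
      comp f (fun i => if h : i < k then w ⟨i, h⟩ else 1) k '' tailSet f k := by
  rintro x ⟨a, ha, hx⟩
  have hmono : StrictMono a := strictMono_nat_of_lt_succ fun n => by
    have := (hΦ (a n)).trans_lt (ha n)
    exact_mod_cast this
  have hle : ∀ n : ℕ, n + 1 ≤ (a n : ℕ) := by
    intro n
    induction n with
    | zero => exact (a 0).pos
    | succ n ih =>
      have : (a n : ℕ) < a (n + 1) := hmono (Nat.lt_succ_self n)
      omega
  rw [hf.isCoding_iff.1 hx, hf.codingPoint_eq_comp a k]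
  refine mem_iUnion.2 ⟨fun i => a i, codingPoint f fun i => a (k + i),
    ⟨fun i => a (k + i), fun n => ?_, hf.isCoding_codingPoint _⟩, ?_⟩
  · have := hle (k + n)
    exact (PNat.coe_le_coe k (a (k + n))).1 (by omega)
  · rw [comp_congr f (b := a) fun i hi => ?_]
    simp [hi]

/-- If the points `f i 0` are `t`-box covered and `1 / d < t < s`, then the packing measure of
dimension `s` vanishes: `growthSet f Φ` is a countable union of Lipschitz images of one `t`-box
covered tail set. -/
lemma packingMeasure_growthSet_eq_zero (hf : IsDecaying d f) {Φ : ℕ+ → ℝ}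
    (hΦ : ∀ n : ℕ+, (n : ℝ) ≤ Φ n) {t : ℝ} {s : ℝ≥0} (ht : 1 / d < t) (hts : t < s)
    (h0 : BoxCovered t (range fun i : ℕ+ => f i 0)) : packingMeasure s (growthSet f Φ) = 0 := by
  obtain ⟨k, hk⟩ := hf.exists_boxCovered_tailSet ht h0
  refine packingMeasure_eq_zero_of_countable _ (hf.growthSet_subset hΦ k) fun w => ?_
  refine packingPre_eq_zero_of_boxCovered (t := t) ?_ hts
  obtain ⟨L, hL, hlip⟩ := hf.comp_bilipschitz (fun i => if h : i < k then w ⟨i, h⟩ else 1) k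
  rw [image_eq_range]
  refine BoxCovered.of_lipschitz (v := fun x : tailSet f k => (x : ℝ)) hL
    (fun x y => (hlip _ (hf.tailSet_subset_Icc k x.2) _ (hf.tailSet_subset_Icc k y.2)).1) ?_
  rwa [Subtype.range_coe]

end IsDecaying

/-! ### Disjoint intervals, Baire category and the lower bound -/

/-- An interval of length `2 * r` meets the closures of at most two disjoint open intervals that are
longer than `2 * r`: one that sticks out on the right and one that sticks out on the left. -/
lemma card_le_two_mul_card {ι : Type*} {B : Finset ι} {T : Finset ℝ} {r : ℝ} {u v p : ι → ℝ}
    (hlen : ∀ i ∈ B, 2 * r < v i - u i) (hp : ∀ i ∈ B, p i ∈ Icc (u i) (v i))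
    (hdisj : ∀ i ∈ B, ∀ j ∈ B, i ≠ j → Disjoint (Ioo (u i) (v i)) (Ioo (u j) (v j)))
    (hT : ∀ i ∈ B, ∃ y ∈ T, |p i - y| ≤ r) : B.card ≤ 2 * T.card := by
  classical
  choose! y hyT hy using hT
  have hle : B.card ≤ (T ×ˢ (Finset.univ : Finset Bool)).card := by
    refine Finset.card_le_card_of_injOn (fun i => (y i, decide (y i + r < v i))) ?_ ?_
    · intro i hi
      exact Finset.mem_coe.2 (Finset.mem_product.2 ⟨hyT i hi, Finset.mem_univ _⟩)
    · intro i hi j hj hij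
      by_contra hne
      have hd := Set.disjoint_left.1 (hdisj i hi j hj hne)
      simp only [Prod.mk.injEq, decide_eq_decide] at hij
      obtain ⟨hyy, hiff⟩ := hij
      have hi1 := abs_le.1 (hy i hi)
      have hj1 := abs_le.1 (hy j hj)
      have hi2 := hp i hi
      have hj2 := hp j hj
      have hi3 := hlen i hi
      have hj3 := hlen j hj
      rw [← hyy] at hj1 hiff
      by_cases h : y i + r < v i
      · have h' := hiff.1 h
        obtain ⟨z, hz1, hz2⟩ := exists_between (lt_min h h')
        exact hd (a := z) ⟨by linarith [hi2.1], hz2.trans_le (min_le_left _ _)⟩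
          ⟨by linarith [hj2.1], hz2.trans_le (min_le_right _ _)⟩
      · have h' : ¬ y i + r < v j := fun hh => h (hiff.2 hh)
        rw [not_lt] at h h'
        have h1 : max (u i) (u j) < y i - r := max_lt (by linarith) (by linarith)
        obtain ⟨z, hz1, hz2⟩ := exists_between h1
        exact hd (a := z) ⟨(le_max_left _ _).trans_lt hz1, by linarith [hi2.2]⟩
          ⟨(le_max_right _ _).trans_lt hz1, by linarith [hj2.2]⟩
  simpa [mul_comm] using hle

/-- A digit sequence that starts with `b` and satisfies `Φ (a n) < a (n + 1)`. -/
def growthSeq (Φ : ℕ+ → ℝ) (b : ℕ+) : ℕ → ℕ+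
  | 0 => b
  | n + 1 => ⌈Φ (growthSeq Φ b n)⌉₊.succPNat

lemma lt_growthSeq_succ (Φ : ℕ+ → ℝ) (b : ℕ+) (n : ℕ) :
    Φ (growthSeq Φ b n) < (growthSeq Φ b (n + 1) : ℝ) := by
  rw [growthSeq, Nat.succPNat_coe, Nat.cast_succ]
  exact (Nat.le_ceil _).trans_lt (lt_add_one _)

namespace IsDecaying

lemma exists_Ioo_subset_image (hf : IsDecaying d f) (i : ℕ+) :
    ∃ u v : ℝ, |f i 1 - f i 0| = v - u ∧ Ioo u v ⊆ f i '' Ioo 0 1 ∧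
      ∀ x ∈ Icc (0 : ℝ) 1, f i x ∈ Icc u v := by
  have hd : 0 < 1 / d := one_div_pos.2 hf.pos
  have h0 : (0 : ℝ) ∈ Icc (0 : ℝ) 1 := ⟨le_rfl, zero_le_one⟩
  have h1 : (1 : ℝ) ∈ Icc (0 : ℝ) 1 := ⟨zero_le_one, le_rfl⟩
  obtain ⟨c, hc, hc'⟩ := hf.exists_le_abs_sub (τ := 1 / d / 2) (by linarith) (by linarith)
  have hcont := (hf.differentiableOn i).continuousOn
  have hinj : InjOn (f i) (Icc 0 1) := by
    intro x hx y hy hxy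
    have h := hc' i x hx y hy
    have hpos : 0 < c / (i : ℝ) ^ (1 / (1 / d / 2)) :=
      div_pos hc (Real.rpow_pos_of_pos (by simp) _)
    rw [hxy, sub_self, abs_zero] at h
    have h2 : |x - y| ≤ 0 := nonpos_of_mul_nonpos_right h hpos
    exact sub_eq_zero.1 (abs_nonpos_iff.1 h2)
  rcases hcont.strictMonoOn_of_injOn_Icc' zero_le_one hinj with hm | hm
  · refine ⟨f i 0, f i 1, abs_of_nonneg (sub_nonneg.2 (hm.monotoneOn h0 h1 zero_le_one)),
      intermediate_value_Ioo zero_le_one hcont, fun x hx =>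
      ⟨hm.monotoneOn h0 hx hx.1, hm.monotoneOn hx h1 hx.2⟩⟩
  · refine ⟨f i 1, f i 0, ?_, intermediate_value_Ioo' zero_le_one hcont, fun x hx =>
      ⟨hm.antitoneOn hx h1 hx.2, hm.antitoneOn h0 hx hx.1⟩⟩
    rw [abs_sub_comm, abs_of_nonneg (sub_nonneg.2 (hm.antitoneOn h0 h1 zero_le_one))]

/-- The images of the maps `f b` with `b ≤ N` are disjoint intervals of length about `N ^ (-d)` at
least, so that a set with a point in each of them needs about `N` intervals of radius `N ^ (-d)`. -/
lemma one_div_le_of_boxCovered (hf : IsDecaying d f) {s : ℝ} (hs : 0 ≤ s) (M : ℕ+) {x : ℕ+ → ℝ}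
    (hx : ∀ b, x b ∈ Icc (0 : ℝ) 1)
    (h : BoxCovered s (range fun b : {b : ℕ+ // M < b} => f b (x b))) : 1 / d ≤ s := by
  by_contra hlt
  push Not at hlt
  obtain ⟨τ, hτ1, hτ2⟩ := exists_between hlt
  have hτ0 : 0 < τ := hs.trans_lt hτ1
  obtain ⟨c', hc'0, hc'⟩ := hf.exists_le_abs_sub hτ0 hτ2
  obtain ⟨K, hK⟩ := h
  set c := min c' 1 with hcdef
  have hc : 0 < c := lt_min hc'0 one_pos
  set K' := K * (c / 3) ^ (-s) with hK'
  have hcount : ∀ N : ℕ+, ((N : ℕ) : ℝ) - (M : ℕ) ≤ 2 * (K' * ((N : ℕ) : ℝ) ^ (s / τ)) := by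
    intro N
    have hN1 : (1 : ℝ) ≤ (N : ℕ) := by exact_mod_cast N.pos
    have hNτ : 1 ≤ ((N : ℕ) : ℝ) ^ (1 / τ) := Real.one_le_rpow hN1 (by positivity)
    have hr0 : 0 < c / 3 / ((N : ℕ) : ℝ) ^ (1 / τ) := by positivity
    obtain ⟨T, hT, hcov⟩ := hK (c / 3 / ((N : ℕ) : ℝ) ^ (1 / τ)) hr0 (by
      rw [div_le_one (by positivity)]
      have : c ≤ 1 := min_le_right _ _
      linarith)
    choose u v huv hsub hmem using hf.exists_Ioo_subset_image
    have hcard : (Finset.Ioc M N).card ≤ 2 * T.card := by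
      refine card_le_two_mul_card (u := u) (v := v) (p := fun b => f b (x b))
        (r := c / 3 / ((N : ℕ) : ℝ) ^ (1 / τ)) ?_ (fun b _ => hmem b _ (hx b)) ?_ ?_
      · intro b hb
        have hbN : ((b : ℕ) : ℝ) ≤ (N : ℕ) := by exact_mod_cast (Finset.mem_Ioc.1 hb).2
        have hb0 : (0 : ℝ) < (b : ℕ) := by exact_mod_cast b.pos
        have h1 := hc' b 1 ⟨zero_le_one, le_rfl⟩ 0 ⟨le_rfl, zero_le_one⟩
        rw [huv b, sub_zero, abs_one, mul_one] at h1
        have h2 : c / ((N : ℕ) : ℝ) ^ (1 / τ) ≤ c' / ((b : ℕ) : ℝ) ^ (1 / τ) := by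
          gcongr
          exact min_le_left _ _
        have h3 : c / 3 / ((N : ℕ) : ℝ) ^ (1 / τ) = c / ((N : ℕ) : ℝ) ^ (1 / τ) / 3 := by ring
        rw [h3] at hr0 ⊢
        linarith
      · intro b _ b' _ hne
        refine Set.disjoint_of_subset (hsub b) (hsub b') ?_
        exact Set.disjoint_iff_inter_eq_empty.2 (hf.disjoint b b' hne)
      · intro b hb
        exact hcov _ ⟨⟨b, (Finset.mem_Ioc.1 hb).1⟩, rfl⟩
    rw [PNat.card_Ioc] at hcard
    have h1 : ((N : ℕ) : ℝ) - (M : ℕ) ≤ 2 * T.card := by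
      have : (N : ℕ) ≤ 2 * T.card + M := by omega
      have : ((N : ℕ) : ℝ) ≤ 2 * T.card + (M : ℕ) := by exact_mod_cast this
      linarith
    refine h1.trans ?_
    have h2 : K * (c / 3 / ((N : ℕ) : ℝ) ^ (1 / τ)) ^ (-s) = K' * ((N : ℕ) : ℝ) ^ (s / τ) := by
      rw [Real.div_rpow (by positivity) (by positivity), ← Real.rpow_mul (by positivity), hK',
        show 1 / τ * -s = -(s / τ) by ring, Real.rpow_neg (by positivity : (0 : ℝ) ≤ (N : ℕ)),
        div_inv_eq_mul, mul_assoc]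
    rw [← h2]
    linarith
  -- divide by `N` and let `N → ∞`; the right side tends to `0` because `s < τ`
  have hlim1 : Tendsto (fun n : ℕ => 1 - ((M : ℕ) : ℝ) / (n : ℝ)) atTop (𝓝 (1 - 0)) :=
    (tendsto_const_div_atTop_nhds_zero_nat _).const_sub 1
  have hexp : 0 < 1 - s / τ := sub_pos.2 ((div_lt_one hτ0).2 hτ1)
  have hlim2 : Tendsto (fun n : ℕ => 2 * (K' * (n : ℝ) ^ (-(1 - s / τ)))) atTop
      (𝓝 (2 * (K' * 0))) :=
    (((tendsto_rpow_neg_atTop hexp).comp tendsto_natCast_atTop_atTop).const_mul K').const_mul 2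
  have h01 := le_of_tendsto_of_tendsto hlim1 hlim2 (by
    filter_upwards [eventually_gt_atTop 0] with n hn
    have hn0 : (0 : ℝ) < n := by exact_mod_cast hn
    have h1 := hcount ⟨n, hn⟩
    rw [PNat.mk_coe] at h1
    have h2 : (n : ℝ) ^ (-(1 - s / τ)) = (n : ℝ) ^ (s / τ) / n := by
      rw [neg_sub, Real.rpow_sub_one hn0.ne']
    rw [h2]
    calc 1 - ((M : ℕ) : ℝ) / (n : ℝ) = (n - (M : ℕ)) / n := by field_simp
      _ ≤ 2 * (K' * (n : ℝ) ^ (s / τ)) / n := by gcongr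
      _ = _ := by ring)
  norm_num at h01

/-- At scale `r`, all but `O(r ^ (-t))` of the points `f b 0` are within `r / 2` of the points
`f b (x b)`. -/
lemma boxCovered_range_zero (hf : IsDecaying d f) {s t : ℝ} (hst : s ≤ t) (ht : 1 / d < t) (M : ℕ+)
    {x : ℕ+ → ℝ} (hx : ∀ b, x b ∈ Icc (0 : ℝ) 1)
    (h : BoxCovered s (range fun b : {b : ℕ+ // M < b} => f b (x b))) :
    BoxCovered t (range fun b : ℕ+ => f b 0) := by
  classical
  have ht0 : 0 < t := (one_div_pos.2 hf.pos).trans ht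
  obtain ⟨C, hC, hlip⟩ := hf.exists_abs_sub_le ht
  obtain ⟨K, hK⟩ := h
  have hKnonneg : 0 ≤ K := by
    obtain ⟨T, hT, -⟩ := hK 1 one_pos le_rfl
    rw [Real.one_rpow, mul_one] at hT
    exact (Nat.cast_nonneg _).trans hT
  refine ⟨K * 2 ^ s + ((M : ℕ) + 1 + (2 * C) ^ t), fun r hr hr1 => ?_⟩
  obtain ⟨T, hT, hcov⟩ := hK (r / 2) (by linarith) (by linarith)
  -- for `b > (2 * C / r) ^ t` the interval `f b '' [0, 1]` is shorter than `r / 2`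
  set n : ℕ := M + ⌊(2 * C / r) ^ t⌋₊ with hn
  have hrt : 1 ≤ r ^ (-t) := Real.one_le_rpow_of_pos_of_le_one_of_nonpos hr hr1 (by linarith)
  refine ⟨T ∪ (Finset.range (n + 1)).image fun b => f b.toPNat' 0, ?_, ?_⟩
  · have h1 : (T.card : ℝ) ≤ K * 2 ^ s * r ^ (-t) := by
      refine hT.trans ?_
      rw [Real.div_rpow hr.le (by norm_num), Real.rpow_neg (by norm_num : (0 : ℝ) ≤ 2),
        div_inv_eq_mul, mul_comm (r ^ (-s)), ← mul_assoc]
      exact mul_le_mul_of_nonneg_left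
        (Real.rpow_le_rpow_of_exponent_ge hr hr1 (by linarith)) (by positivity)
    have h2 : (((Finset.range (n + 1)).image fun b => f b.toPNat' 0).card : ℝ) ≤
        ((M : ℕ) + 1 + (2 * C) ^ t) * r ^ (-t) := by
      have h3 : ((Finset.range (n + 1)).image fun b => f b.toPNat' 0).card ≤ n + 1 :=
        Finset.card_image_le.trans (Finset.card_range _).le
      have h4 : (2 * C / r) ^ t = (2 * C) ^ t * r ^ (-t) := by
        rw [Real.div_rpow (by positivity) hr.le, Real.rpow_neg hr.le, div_eq_mul_inv]
      have h5 : (⌊(2 * C / r) ^ t⌋₊ : ℝ) ≤ (2 * C) ^ t * r ^ (-t) :=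
        h4 ▸ Nat.floor_le (by positivity)
      calc (((Finset.range (n + 1)).image fun b => f b.toPNat' 0).card : ℝ) ≤ (n + 1 : ℕ) := by
            exact_mod_cast h3
        _ = ((M : ℕ) + 1) * 1 + ⌊(2 * C / r) ^ t⌋₊ := by rw [hn]; push_cast; ring
        _ ≤ ((M : ℕ) + 1) * r ^ (-t) + (2 * C) ^ t * r ^ (-t) := by gcongr
        _ = _ := by ring
    calc ((T ∪ (Finset.range (n + 1)).image fun b => f b.toPNat' 0).card : ℝ)
        ≤ T.card + ((Finset.range (n + 1)).image fun b => f b.toPNat' 0).card := by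
          exact_mod_cast Finset.card_union_le _ _
      _ ≤ _ := by rw [add_mul]; exact add_le_add h1 h2
  · rintro _ ⟨b, rfl⟩
    by_cases hb : (b : ℕ) ≤ n
    · refine ⟨f b 0, Finset.mem_union_right _ (Finset.mem_image.2 ⟨b, ?_, by simp⟩), ?_⟩
      · exact Finset.mem_range.2 (by omega)
      · simpa using hr.le
    · have hMb : M < b := (PNat.coe_lt_coe M b).1 (by omega)
      obtain ⟨y, hy, hxy⟩ := hcov _ ⟨⟨b, hMb⟩, rfl⟩
      refine ⟨y, Finset.mem_union_left _ hy, ?_⟩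
      have hb0 : (0 : ℝ) < (b : ℕ) := by exact_mod_cast b.pos
      have hlt : (2 * C / r) ^ t < (b : ℕ) := (Nat.floor_lt (by positivity)).1 (by omega)
      have h1 : 2 * C / r ≤ ((b : ℕ) : ℝ) ^ (1 / t) := by
        have := Real.rpow_le_rpow (by positivity) hlt.le (by positivity : 0 ≤ 1 / t)
        rwa [← Real.rpow_mul (by positivity), mul_one_div_cancel ht0.ne', Real.rpow_one] at this
      have h2 : C / ((b : ℕ) : ℝ) ^ (1 / t) ≤ r / 2 := by
        rw [div_le_iff₀ (by positivity)]
        rw [div_le_iff₀ hr] at h1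
        linarith
      have h3 : |f b 0 - f b (x b)| ≤ r / 2 := by
        refine (hlip b 0 ⟨le_rfl, zero_le_one⟩ _ (hx b)).trans ?_
        rw [zero_sub, abs_neg, abs_of_nonneg (hx b).1]
        have := (hx b).2
        have h4 : 0 ≤ C / ((b : ℕ) : ℝ) ^ (1 / t) := by positivity
        nlinarith
      have := abs_sub_le (f b 0) (f b (x b)) y
      dsimp only at hxy ⊢
      linarith

/-- By the Baire category theorem in the space of admissible digit sequences, one of the members of
a countable cover of `growthSet f Φ` is dense in the image of a cylinder. -/
lemma exists_cylinder_subset_closure (hf : IsDecaying d f) (Φ : ℕ+ → ℝ) {F : ℕ → Set ℝ}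
    (hF : growthSet f Φ ⊆ ⋃ i, F i) :
    ∃ (i k : ℕ) (a : ℕ → ℕ+), (∀ n, Φ (a n) < (a (n + 1) : ℝ)) ∧
      ∀ b : ℕ → ℕ+, (∀ n, Φ (b n) < (b (n + 1) : ℝ)) → (∀ n < k, b n = a n) →
        codingPoint f b ∈ closure (F i) := by
  set S : Set (ℕ → ℕ+) := {a | ∀ n, Φ (a n) < (a (n + 1) : ℝ)} with hS
  have hSc : IsClosed S := by
    rw [hS, ofPred_forall]
    refine isClosed_iInter fun n => ?_
    have hn : Continuous fun a : ℕ → ℕ+ => (a n, a (n + 1)) :=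
      (continuous_apply n).prodMk (continuous_apply (n + 1))
    exact (isClosed_discrete {p : ℕ+ × ℕ+ | Φ p.1 < (p.2 : ℝ)}).preimage hn
  have : Nonempty S := ⟨⟨growthSeq Φ 1, lt_growthSeq_succ Φ 1⟩⟩
  have : TopologicalSpace.IsCompletelyMetrizableSpace S := hSc.isCompletelyMetrizableSpace
  have hcont : Continuous fun a : S => codingPoint f a :=
    hf.continuous_codingPoint.comp continuous_subtype_val
  obtain ⟨i, ⟨a, haS⟩, ha⟩ := nonempty_interior_of_iUnion_of_closed
    (f := fun i => (fun a : S => codingPoint f a) ⁻¹' closure (F i))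
    (fun i => isClosed_closure.preimage hcont) (by
      rw [eq_univ_iff_forall]
      intro a
      obtain ⟨i, hi⟩ := mem_iUnion.1 (hF ⟨a.1, a.2, hf.isCoding_codingPoint a.1⟩)
      exact mem_iUnion.2 ⟨i, subset_closure hi⟩)
  rw [mem_interior_iff_mem_nhds, nhds_subtype, mem_comap] at ha
  obtain ⟨U, hU, hUsub⟩ := ha
  obtain ⟨V, hVU, hV, haV⟩ := mem_nhds_iff.1 hU
  obtain ⟨_, ⟨x, k, rfl⟩, hax, hsub⟩ :=
    (PiNat.isTopologicalBasis_cylinders fun _ : ℕ => ℕ+).exists_subset_of_mem_open haV hV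
  refine ⟨i, k, a, haS, fun b hb hba => hUsub (a := ⟨b, hb⟩) (hVU (hsub ?_))⟩
  exact fun n hn => (hba n hn).trans (hax n hn)

/-- If the packing measure of `growthSet f Φ` is finite, then a set of points `f b (x b)`, one for
each large `b`, is box covered: the closure of a box covered member of a countable cover contains
the image of a cylinder, and in it a bi-Lipschitz copy of such a set. -/
lemma exists_boxCovered_of_packingMeasure_ne_top (hf : IsDecaying d f) {Φ : ℕ+ → ℝ} {s : ℝ≥0}
    (h : packingMeasure s (growthSet f Φ) ≠ ∞) :
    ∃ (M : ℕ+) (x : ℕ+ → ℝ), (∀ b, x b ∈ Icc (0 : ℝ) 1) ∧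
      BoxCovered s (range fun b : {b : ℕ+ // M < b} => f b (x b)) := by
  have h' : packingMeasure s (growthSet f Φ) < ∞ := lt_top_iff_ne_top.2 h
  simp only [packingMeasure, iInf_lt_iff] at h'
  obtain ⟨F, hF, hlt⟩ := h'
  obtain ⟨i, k, a, ha, hcyl⟩ := hf.exists_cylinder_subset_closure Φ hF
  have hbox : BoxCovered s (closure (F i)) :=
    (boxCovered_of_packingPre_ne_top (ENNReal.ne_top_of_tsum_ne_top hlt.ne i)).closure
  obtain ⟨L, hL, hlip⟩ := hf.comp_bilipschitz a (k + 1)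
  set x : ℕ+ → ℝ := fun b => codingPoint f fun n => growthSeq Φ b (n + 1) with hx
  have hxmem : ∀ b, x b ∈ Icc (0 : ℝ) 1 := fun b => hf.codingPoint_mem _
  refine ⟨⌈Φ (a k)⌉₊.succPNat, x, hxmem, ?_⟩
  refine BoxCovered.of_lipschitz
    (v := fun b : {b : ℕ+ // ⌈Φ (a k)⌉₊.succPNat < b} => comp f a (k + 1) (f b (x b)))
    hL (fun b b' => (hlip _ (hf.mapsTo _ (hxmem b)) _ (hf.mapsTo _ (hxmem b'))).2)
    (hbox.mono ?_)
  rintro _ ⟨⟨b, hb⟩, rfl⟩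
  have hb' : Φ (a k) < (b : ℝ) := by
    have h1 : ⌈Φ (a k)⌉₊ + 1 < (b : ℕ) := by
      have := (PNat.coe_lt_coe _ b).2 hb
      simpa using this
    have h2 : ((⌈Φ (a k)⌉₊ : ℕ) : ℝ) < (b : ℕ) := by exact_mod_cast (by omega : ⌈Φ (a k)⌉₊ < (b : ℕ))
    exact (Nat.le_ceil _).trans_lt h2
  -- the digits `a 0, …, a k` followed by an admissible sequence that starts with `b`
  set w : ℕ → ℕ+ := fun n => if n ≤ k then a n else growthSeq Φ b (n - (k + 1)) with hw
  have hw1 : ∀ n ≤ k, w n = a n := fun n hn => if_pos hn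
  have hw2 : ∀ n, w (k + 1 + n) = growthSeq Φ b n := fun n => by
    rw [hw]
    dsimp only
    rw [if_neg (by omega), Nat.add_sub_cancel_left]
  have hmem := hcyl w ?_ fun n hn => hw1 n hn.le
  · have hfun : (fun n => w (k + 1 + n)) = growthSeq Φ b := funext hw2
    rw [hf.codingPoint_eq_comp w (k + 1), hfun, hf.codingPoint_eq_apply,
      comp_congr f fun n hn => hw1 n (by omega)] at hmem
    exact hmem
  · intro n
    rcases lt_trichotomy n k with hn | rfl | hn
    · rw [hw1 n hn.le, hw1 (n + 1) hn]
      exact ha n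
    · have := hw2 0
      rw [add_zero] at this
      rw [hw1 n le_rfl, this]
      exact hb'
    · obtain ⟨m, rfl⟩ := Nat.exists_eq_add_of_lt hn
      rw [show k + m + 1 = k + 1 + m by ring, hw2, add_assoc, hw2]
      exact lt_growthSeq_succ Φ b m

end IsDecaying

end DecayingIFS

end

theorem theorem2 (d : ℝ) (f : ℕ+ → ℝ → ℝ) (hf : DecayingIFS.IsDecaying d f)
    (Φ : ℕ+ → ℝ) (hΦ : ∀ n : ℕ+, (n : ℝ) ≤ Φ n) :
    DecayingIFS.packingDim (DecayingIFS.growthSet f Φ) =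
      max (DecayingIFS.upperBoxDim (Set.range fun i : ℕ+ => f i 0)) (ENNReal.ofReal (1 / d)) := by
  have hd : 0 < 1 / d := one_div_pos.2 hf.pos
  apply le_antisymm
  · refine iSup₂_le fun s hs => ?_
    by_contra hlt
    push Not at hlt
    obtain ⟨t, ht, hts⟩ := ENNReal.lt_iff_exists_nnreal_btwn.1 hlt
    have ht1 : 1 / d < t := by
      have h := (le_max_right _ _).trans_lt ht
      rwa [← ENNReal.ofReal_coe_nnreal, ENNReal.ofReal_lt_ofReal_iff_of_nonneg hd.le] at h
    have hts' : (t : ℝ) < s := by exact_mod_cast hts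
    have hzero := hf.packingMeasure_growthSet_eq_zero hΦ ht1 hts'
      (DecayingIFS.boxCovered_of_upperBoxDim_lt ((le_max_left _ _).trans_lt ht))
    rw [hzero] at hs
    exact ENNReal.zero_ne_top hs
  · by_contra hlt
    push Not at hlt
    obtain ⟨s, hs, hsmax⟩ := ENNReal.lt_iff_exists_nnreal_btwn.1 hlt
    have hne : DecayingIFS.packingMeasure s (DecayingIFS.growthSet f Φ) ≠ ∞ := fun h =>
      absurd (le_iSup₂_of_le (f := fun (s : ℝ≥0)
        (_ : DecayingIFS.packingMeasure s (DecayingIFS.growthSet f Φ) = ∞) => (s : ℝ≥0∞))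
        s h le_rfl) (not_le.2 hs)
    obtain ⟨M, x, hx, hbox⟩ := hf.exists_boxCovered_of_packingMeasure_ne_top hne
    have h1 : 1 / d ≤ s := hf.one_div_le_of_boxCovered s.2 M hx hbox
    refine absurd hsmax (not_lt.2 (max_le ?_ ?_))
    · refine le_of_forall_gt_imp_ge_of_dense fun b hb => ?_
      induction b with
      | top => exact le_top
      | coe t =>
        have hst : (s : ℝ) < t := by exact_mod_cast hb
        exact DecayingIFS.upperBoxDim_le_of_boxCovered
          (hf.boxCovered_range_zero hst.le (h1.trans_lt hst) M hx hbox)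
    · rw [← ENNReal.ofReal_coe_nnreal]
      exact ENNReal.ofReal_le_ofReal h1
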